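/- All manifolds are $C^\infty$, Hausdorff, second countable and without boundary. A simple space is a second countable metrizable space $X=R\sqcup\Sigma$ with $R$ open and dense, where $R$ (the regular part) is an $n$-manifold and each connected component $S$ of $\Sigma$ (a singular stratum) is open in $\Sigma$ and is a manifold. A morphism of simple spaces is a continuous map that sends $R$ smoothly into $R'$ and each singular stratum smoothly into a singular stratum. Let $c(L)=L\times[0,\infty)/L\times\{0\}$ be the open cone of a compact manifold $L$, with vertex $v$ and points $[l,r]$. A chart at $S$ is an open embedding $\alpha:U\times c(L)\to X$, with $U\subset S$ open and $\alpha(u,v)=u$, that restricts to a diffeomorphism of $U\times L\times(0,\infty)$ onto an open subset of $R$. A tubular neighbourhood of a singular stratum $S$ is a fibre bundle $\tau:T\to S$ with fibre $c(L_S)$, where $L_S$ is a compact manifold, $T\supset S$ is open in $X$ and $\tau|_S=\mathrm{id}$, with an atlas of bundle charts $\alpha:U\times c(L_S)\to\tau^{-1}(U)$ that are charts at $S$ and whose changes of charts are $(u,[l,r])\mapsto(u,[g(u)(l),r])$ with $g(u)\in\mathrm{Diff}(L_S)$. A Thom-Mather space is a simple space with a tubular neighbourhood of each singular stratum. A Thom-Mather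 morphism is a morphism of simple spaces $f:X\to X'$ that preserves the tubular neighbourhoods as bundles with structure group: for $u\in S$, $f(u)\in S'$ and bundle charts $\alpha,\alpha'$ over $u,f(u)$ there is a smooth $g:L_S\to L_{S'}$ with $f(\alpha(u,[l,r]))=\alpha'(f(u),[g(l),r])$ for all $l,r$. A Thom-Mather isomorphism is a homeomorphism $f$ such that $f$ and $f^{-1}$ are Thom-Mather morphisms. An unfolding of $X$ with $k\ge1$ copies of $R$ is an $n$-manifold $\widetilde X$ with a continuous proper map $\mathcal L:\widetilde X\to X$ such that $\mathcal L^{-1}(R)$ is a disjoint union of $k$ open sets, each mapped diffeomorphically onto $R$ by $\mathcal L$, and each $z\in\mathcal L^{-1}(\Sigma)$ has a chart $\alpha:U\times c(L)\to X$ with $\mathcal L(z)\in U$ and a diffeomorphism $\widetilde\alpha:U\times L\times\mathbb R\to\mathcal L^{-1}(\operatorname{Im}\alpha)$ with $\mathcal L(\widetilde\alpha(u,l,t))=\alpha(u,[l,|t|])$. It is primary if $k=2$. It is adapted to the Thom-Mather structure if these $\alpha$ can be taken to be bundle charts of the tubular neighbourhoods. The bubbles of $\widetilde X$ are the connected components of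 $\mathcal L^{-1}(R)$. Let $f:X\to X'$ be a homeomorphism. A bubble permutation over $f$ is a bijection $\sigma$ from the bubbles of $\widetilde X$ to those of $\widetilde X'$ with $\mathcal L'(\sigma(B))=f(\mathcal L(B))$ for every bubble $B$. A lifting of $f$ with $\sigma$ is a continuous map $\widetilde f:\widetilde X\to\widetilde X'$ with $\mathcal L'\widetilde f=f\mathcal L$ and $\widetilde f(B)\subset\sigma(B)$ for every bubble $B$. **Theorem.** Let $X,X'$ be Thom-Mather spaces, let $\mathcal L:\widetilde X\to X$ and $\mathcal L':\widetilde X'\to X'$ be adapted unfoldings with the same number $k$ of copies of the regular parts (for example two adapted primary unfoldings), and let $f:X\to X'$ be a Thom-Mather isomorphism. Then bubble permutations over $f$ exist. For every bubble permutation $\sigma$ over $f$, there is exactly one lifting $\widetilde f$ of $f$ with $\sigma$, and it is a (smooth) diffeomorphism $\widetilde X\to\widetilde X'$; moreover $\sigma^{-1}$ is a bubble permutation over $f^{-1}$, and $\widetilde f^{-1}$ is the unique lifting of $f^{-1}$ with $\sigma^{-1}$. -/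

import Mathlib

open scoped Manifold ContDiff NNReal
open Set TopologicalSpace

universe u v w

/-! ### Open cones -/

/-- The radius on `{v} ⊔ L × [0,∞)`; the extra point `v` makes the cone over `∅` a single point. -/
def preConeRadius (L : Type v) : Unit ⊕ (L × ℝ≥0) → ℝ≥0 :=
  Sum.elim (fun _ => 0) Prod.snd

/-- All points of radius `0` are identified, nothing else is. -/
def coneSetoid (L : Type v) : Setoid (Unit ⊕ (L × ℝ≥0)) where
  r p q := p = q ∨ (preConeRadius L p = 0 ∧ preConeRadius L q = 0)
  iseqv :=
    { refl := fun _ => Or.inl rfl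
      symm := by
        rintro p q (h | h)
        · exact Or.inl h.symm
        · exact Or.inr h.symm
      trans := by
        rintro p q r (rfl | h) (rfl | h')
        · exact Or.inl rfl
        · exact Or.inr h'
        · exact Or.inr h
        · exact Or.inr ⟨h.1, h'.2⟩ }

/-- The open cone `c(L) = L × [0,∞) / L × {0}`, with `c(∅)` a single point. -/
def OpenCone (L : Type v) : Type v := Quotient (coneSetoid L)

instance (L : Type v) [TopologicalSpace L] : TopologicalSpace (OpenCone L) :=
  inferInstanceAs (TopologicalSpace (Quotient (coneSetoid L)))

/-- The vertex of the open cone. -/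
def OpenCone.vertex (L : Type v) : OpenCone L := Quotient.mk (coneSetoid L) (Sum.inl ())

/-- The class `[l, r]` in the open cone. -/
def OpenCone.mk {L : Type v} (l : L) (r : ℝ≥0) : OpenCone L :=
  Quotient.mk (coneSetoid L) (Sum.inr (l, r))

/-- The half-line `(0,∞)` as an open subset of `ℝ`, hence as a manifold. -/
def posReal : Opens ℝ := ⟨Ioi 0, isOpen_Ioi⟩

/-! ### Simple spaces -/

/-- The singular stratum `s`, a connected component of the complement of `R`, as a subset of `X`. -/
def stratumSet {X : Type u} [TopologicalSpace X] (R : Opens X)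
    (s : ConnectedComponents ↥((R : Set X)ᶜ)) : Set X :=
  Subtype.val '' {x : ↥((R : Set X)ᶜ) | ConnectedComponents.mk x = s}

/-- A decomposition of `X` into an open dense regular part `reg`, a smooth manifold of
dimension `n`, and its complement, the singular part, a smooth manifold too. The latter is given
by a smooth structure on each of its connected components (the singular strata), which are open in
the singular part; different singular strata may have different dimensions. -/
structure SimpleSpace (n : ℕ) (X : Type u) [TopologicalSpace X] where
  reg : Opens X
  dense_reg : Dense (reg : Set X)
  regCharted : ChartedSpace (EuclideanSpace ℝ (Fin n)) reg
  regManifold : IsManifold (𝓡 n) ∞ reg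
  isOpen_stratum : ∀ s : ConnectedComponents ↥((reg : Set X)ᶜ),
    IsOpen {x : ↥((reg : Set X)ᶜ) | ConnectedComponents.mk x = s}
  dim : ConnectedComponents ↥((reg : Set X)ᶜ) → ℕ
  stratumCharted : ∀ s, ChartedSpace (EuclideanSpace ℝ (Fin (dim s))) ↥(stratumSet reg s)
  stratumManifold : ∀ s, IsManifold (𝓡 (dim s)) ∞ ↥(stratumSet reg s)

attribute [instance] SimpleSpace.regCharted SimpleSpace.regManifold
  SimpleSpace.stratumCharted SimpleSpace.stratumManifold

/-- The index set of the singular strata. -/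
abbrev SimpleSpace.Strata {n : ℕ} {X : Type u} [TopologicalSpace X] (D : SimpleSpace n X) : Type u :=
  ConnectedComponents ↥((D.reg : Set X)ᶜ)

/-- A singular stratum as a subset of `X`. -/
abbrev SimpleSpace.stratum {n : ℕ} {X : Type u} [TopologicalSpace X] (D : SimpleSpace n X)
    (s : D.Strata) : Set X :=
  stratumSet D.reg s

/-- A morphism of simple spaces: a continuous map that preserves the decompositions and is smooth
on the regular part and on each singular stratum. -/
structure IsSimpleMorphism {n n' : ℕ} {X : Type u} {X' : Type w}
    [TopologicalSpace X] [TopologicalSpace X']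
    (D : SimpleSpace n X) (D' : SimpleSpace n' X') (f : X → X') : Prop where
  continuous : Continuous f
  smooth_reg : ∃ h : MapsTo f (D.reg : Set X) (D'.reg : Set X'),
    ContMDiff (𝓡 n) (𝓡 n') ∞ (fun x : D.reg => (⟨f x, h x.2⟩ : D'.reg))
  smooth_stratum : ∀ s : D.Strata, ∃ (s' : D'.Strata) (h : MapsTo f (D.stratum s) (D'.stratum s')),
    ContMDiff (𝓡 (D.dim s)) (𝓡 (D'.dim s')) ∞
      (fun x : D.stratum s => (⟨f x, h x.2⟩ : D'.stratum s'))

/-! ### Charts and tubular neighbourhoods -/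

/-- A compact smooth manifold without boundary, to serve as a link. -/
structure CompactManifold : Type (v + 1) where
  carrier : Type v
  dim : ℕ
  top : TopologicalSpace carrier
  charted : ChartedSpace (EuclideanSpace ℝ (Fin dim)) carrier
  manifold : IsManifold (𝓡 dim) ∞ carrier
  compact : CompactSpace carrier
  t2 : T2Space carrier

attribute [instance] CompactManifold.top CompactManifold.charted CompactManifold.manifold
  CompactManifold.compact CompactManifold.t2

/-- The model with corners of `U × L × ℝ` and `U × L × (0,∞)`, where `dim U = d`, `dim L = e`. -/
noncomputable abbrev pemModel (d e : ℕ) :=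
  (𝓡 d).prod ((𝓡 e).prod 𝓘(ℝ, ℝ))

/-- A chart of `X` at the singular stratum `s` with link `L`: an open set `U` of the stratum and an
embedding of the simple space `U × c(L)` onto an open subset of `X`, with `(u, v) ↦ u`. -/
structure PemChart {n : ℕ} {X : Type u} [TopologicalSpace X] (D : SimpleSpace n X)
    (s : D.Strata) (L : CompactManifold.{v}) where
  U : Opens ↥(D.stratum s)
  toFun : ↥U × OpenCone L.carrier → X
  isOpenEmbedding : Topology.IsOpenEmbedding toFun
  apply_vertex : ∀ u : U, toFun (u, OpenCone.vertex L.carrier) = ((u : D.stratum s) : X)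
  mem_reg : ∀ (u : U) (l : L.carrier) (r : posReal),
    toFun (u, OpenCone.mk l (Real.toNNReal r)) ∈ D.reg
  diffeo_reg : IsLocalDiffeomorph (pemModel (D.dim s) L.dim) (𝓡 n) ∞
    (fun p : ↥U × L.carrier × posReal =>
      (⟨toFun (p.1, OpenCone.mk p.2.1 (Real.toNNReal p.2.2)), mem_reg p.1 p.2.1 p.2.2⟩ : D.reg))

/-- A tubular neighbourhood of the singular stratum `s`: a fibre bundle `proj : T → S` on an open
neighbourhood `T` of the stratum `S`, with fibre `c(L)`, for which the inclusion of `S` is a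
section, given by a bundle atlas whose changes of charts are
`(u, [l, r]) ↦ (u, [g(u)(l), r])` with diffeomorphisms `g(u)` of the link `L`. -/
structure TubularNbhd {n : ℕ} {X : Type u} [TopologicalSpace X] (D : SimpleSpace n X)
    (s : D.Strata) where
  link : CompactManifold.{v}
  T : Opens X
  stratum_subset : D.stratum s ⊆ T
  proj : T → D.stratum s
  continuous_proj : Continuous proj
  proj_self : ∀ x : D.stratum s, proj ⟨x, stratum_subset x.2⟩ = x
  atlas : Set (PemChart D s link)
  exists_chart : ∀ x : D.stratum s, ∃ a ∈ atlas, x ∈ a.U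
  range_chart : ∀ a ∈ atlas, range a.toFun = Subtype.val '' (proj ⁻¹' (a.U : Set (D.stratum s)))
  proj_chart : ∀ a ∈ atlas, ∀ (p : ↥a.U × OpenCone link.carrier) (h : a.toFun p ∈ T),
    proj ⟨a.toFun p, h⟩ = p.1
  cocycle : ∀ a ∈ atlas, ∀ b ∈ atlas, ∀ (x : D.stratum s) (ha : x ∈ a.U) (hb : x ∈ b.U),
    ∃ g : Diffeomorph (𝓡 link.dim) (𝓡 link.dim) link.carrier link.carrier ∞,
      ∀ (l : link.carrier) (r : ℝ≥0),
        a.toFun (⟨x, ha⟩, OpenCone.mk l r) = b.toFun (⟨x, hb⟩, OpenCone.mk (g l) r)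

/-- A Thom–Mather structure: a tubular neighbourhood of every singular stratum. -/
abbrev ThomMather {n : ℕ} {X : Type u} [TopologicalSpace X] (D : SimpleSpace n X) :=
  ∀ s : D.Strata, TubularNbhd.{u, v} D s

/-- A Thom–Mather morphism: a morphism of simple spaces that preserves the tubular neighbourhoods
as bundles with their structure groups, so that in bundle charts over `u` and `f u` it reads
`[l, r] ↦ [g(l), r]` with a smooth map `g` between the links. -/
structure IsThomMatherMorphism {n n' : ℕ} {X : Type u} {X' : Type w}
    [TopologicalSpace X] [TopologicalSpace X'] {D : SimpleSpace n X} {D' : SimpleSpace n' X'}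
    (𝒯 : ThomMather.{u, v} D) (𝒯' : ThomMather.{w, v} D') (f : X → X') : Prop where
  morphism : IsSimpleMorphism D D' f
  preserves_tube : ∀ (s : D.Strata) (s' : D'.Strata),
    ∀ a ∈ (𝒯 s).atlas, ∀ a' ∈ (𝒯' s').atlas, ∀ (x : a.U) (x' : a'.U),
      f ((x : D.stratum s) : X) = ((x' : D'.stratum s') : X') →
      ∃ g : (𝒯 s).link.carrier → (𝒯' s').link.carrier,
        ContMDiff (𝓡 (𝒯 s).link.dim) (𝓡 (𝒯' s').link.dim) ∞ g ∧
        ∀ (l : (𝒯 s).link.carrier) (r : ℝ≥0),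
          f (a.toFun (x, OpenCone.mk l r)) = a'.toFun (x', OpenCone.mk (g l) r)

/-- A Thom–Mather isomorphism: a homeomorphism that is a Thom–Mather morphism in both
directions. -/
def IsThomMatherIso {n n' : ℕ} {X : Type u} {X' : Type w}
    [TopologicalSpace X] [TopologicalSpace X'] {D : SimpleSpace n X} {D' : SimpleSpace n' X'}
    (𝒯 : ThomMather.{u, v} D) (𝒯' : ThomMather.{w, v} D') (f : X ≃ₜ X') : Prop :=
  IsThomMatherMorphism 𝒯 𝒯' f ∧ IsThomMatherMorphism 𝒯' 𝒯 f.symm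

/-! ### Unfoldings -/

/-- The chart `α : U × c(L) → X` is unfolded by `𝓛 : Y → X`: there is a diffeomorphism `αt` of
`U × L × ℝ` onto `𝓛⁻¹(Im α)` with `𝓛 (αt (u, l, t)) = α (u, [l, |t|])`. -/
def PemChart.IsUnfoldedBy {n : ℕ} {X : Type u} [TopologicalSpace X] {D : SimpleSpace n X}
    {s : D.Strata} {L : CompactManifold.{v}} (a : PemChart D s L)
    {Y : Type*} [TopologicalSpace Y] [ChartedSpace (EuclideanSpace ℝ (Fin n)) Y]
    (𝓛 : Y → X) : Prop :=
  ∃ αt : ↥a.U × L.carrier × ℝ → Y,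
    IsLocalDiffeomorph (pemModel (D.dim s) L.dim) (𝓡 n) ∞ αt ∧
    Function.Injective αt ∧
    range αt = 𝓛 ⁻¹' (range a.toFun) ∧
    ∀ (u : a.U) (l : L.carrier) (t : ℝ), 𝓛 (αt (u, l, t)) = a.toFun (u, OpenCone.mk l (Real.nnabs t))

/-- `𝓛 : Y → X` is an unfolding with `k` copies of the regular part. A primary unfolding is one
with `k = 2`. -/
structure IsUnfolding {n : ℕ} {X : Type u} [TopologicalSpace X] (D : SimpleSpace n X) (k : ℕ)
    {Y : Type*} [TopologicalSpace Y] [ChartedSpace (EuclideanSpace ℝ (Fin n)) Y]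
    (𝓛 : Y → X) : Prop where
  proper : IsProperMap 𝓛
  pos : 0 < k
  covering : ∃ B : Fin k → Opens Y,
    Pairwise (fun i j => Disjoint (B i : Set Y) (B j : Set Y)) ∧
    ⋃ i, (B i : Set Y) = 𝓛 ⁻¹' (D.reg : Set X) ∧
    ∀ i, ∃ φ : Diffeomorph (𝓡 n) (𝓡 n) (B i) D.reg ∞, ∀ z : B i, ((φ z : D.reg) : X) = 𝓛 z
  exists_unfolded : ∀ z : Y, 𝓛 z ∉ D.reg →
    ∃ (s : D.Strata) (L : CompactManifold.{v}) (a : PemChart D s L),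
      𝓛 z ∈ Subtype.val '' (a.U : Set (D.stratum s)) ∧ a.IsUnfoldedBy 𝓛

/-- An unfolding is adapted to a Thom–Mather structure if its unfolded charts can be taken over
bundle charts of the tubular neighbourhoods. -/
def IsAdapted {n : ℕ} {X : Type u} [TopologicalSpace X] {D : SimpleSpace n X}
    (𝒯 : ThomMather.{u, v} D)
    {Y : Type*} [TopologicalSpace Y] [ChartedSpace (EuclideanSpace ℝ (Fin n)) Y]
    (𝓛 : Y → X) : Prop :=
  ∀ z : Y, 𝓛 z ∉ D.reg → ∃ s : D.Strata, ∃ a ∈ (𝒯 s).atlas,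
    𝓛 z ∈ Subtype.val '' (a.U : Set (D.stratum s)) ∧ a.IsUnfoldedBy 𝓛

/-! ### Bubbles and liftings -/

/-- The bubbles of an unfolding: the connected components of the preimage of the regular part. -/
abbrev Bubble {n : ℕ} {X : Type u} [TopologicalSpace X] (D : SimpleSpace n X)
    {Y : Type*} [TopologicalSpace Y] (𝓛 : Y → X) :=
  ConnectedComponents ↥(𝓛 ⁻¹' (D.reg : Set X))

/-- A bubble as a subset of the unfolding. -/
def bubbleSet {n : ℕ} {X : Type u} [TopologicalSpace X] (D : SimpleSpace n X)
    {Y : Type*} [TopologicalSpace Y] (𝓛 : Y → X) (b : Bubble D 𝓛) : Set Y :=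
  Subtype.val '' {z : ↥(𝓛 ⁻¹' (D.reg : Set X)) | ConnectedComponents.mk z = b}

/-- The bijection `σ` between the bubbles of two unfoldings lies over `f`:
`𝓛'(σ b) = f(𝓛(b))` for every bubble `b`. -/
def IsBubblePermutation {n n' : ℕ} {X : Type u} {X' : Type w}
    [TopologicalSpace X] [TopologicalSpace X'] (D : SimpleSpace n X) (D' : SimpleSpace n' X')
    {Y Y' : Type*} [TopologicalSpace Y] [TopologicalSpace Y'] (𝓛 : Y → X) (𝓛' : Y' → X')
    (f : X → X') (σ : Bubble D 𝓛 ≃ Bubble D' 𝓛') : Prop :=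
  ∀ b, 𝓛' '' (bubbleSet D' 𝓛' (σ b)) = f '' (𝓛 '' (bubbleSet D 𝓛 b))

/-- `F` is a lifting of `f` with the bubble permutation `σ`. -/
structure IsLifting {n n' : ℕ} {X : Type u} {X' : Type w}
    [TopologicalSpace X] [TopologicalSpace X'] (D : SimpleSpace n X) (D' : SimpleSpace n' X')
    {Y Y' : Type*} [TopologicalSpace Y] [TopologicalSpace Y'] (𝓛 : Y → X) (𝓛' : Y' → X')
    (f : X → X') (σ : Bubble D 𝓛 ≃ Bubble D' 𝓛') (F : Y → Y') : Prop where
  continuous : Continuous F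
  comm : ∀ z, 𝓛' (F z) = f (𝓛 z)
  mapsTo : ∀ b, MapsTo F (bubbleSet D 𝓛 b) (bubbleSet D' 𝓛' (σ b))

/-! Over the regular part there is no freedom. A bubble is connected, so it lies in one of the `k`
copies, and the projection is injective on it; hence a point over `reg` has at most one admissible
image (`IsPointLift.unique`). These points are dense and the unfoldings are Hausdorff, so a lifting
is unique. Existence becomes local: smooth local maps with the right values over `reg` agree near
every point and glue (`exists_contMDiff_of_dense`).

Near a singular point, `f` preserves the radius in bundle charts, so the candidates are `(u, l, t) ↦
(Θ (u, l), ε t)` with `ε = ±1`. Two facts make one of them work. First, `Θ` is jointly smooth,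
although the hypothesis on tubes gives smoothness in `l` only: it can be read off from `f` on the
regular part at radius `1` (`IsThomMatherMorphism.exists_smooth_on_links`). Second, the same sign
serves `t > 0` and `t < 0`: the points at `t = ±1` lie in different bubbles over one point, `σ` is
injective, and only two points lie over the common image (`IsPointLift.exists_sign`). Connectedness
carries the sign through each half (`IsPointLift.of_isPreconnected`).

The liftings of `f` and `f⁻¹` compose to liftings of identities, so they are mutually inverse by
uniqueness. Bubble permutations exist because both regular preimages are `k` copies of the regular
part, and `id × f` matches them. -/

namespace OpenCone

/-! ### Equality of points in an open cone -/

variable {L : Type v}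

theorem mk_eq_mk_iff {l l' : L} {r r' : ℝ≥0} :
    mk l r = mk l' r' ↔ (l = l' ∧ r = r') ∨ (r = 0 ∧ r' = 0) := by
  refine Quotient.eq.trans ?_
  change (Sum.inr (l, r) = Sum.inr (l', r') ∨ (r = 0 ∧ r' = 0)) ↔ _
  simp

theorem mk_eq_vertex_iff {l : L} {r : ℝ≥0} : mk l r = vertex L ↔ r = 0 := by
  refine Quotient.eq.trans ?_
  change (Sum.inr (l, r) = Sum.inl () ∨ (r = 0 ∧ (0 : ℝ≥0) = 0)) ↔ _
  simp

theorem eq_vertex_or_eq_mk (c : OpenCone L) : c = vertex L ∨ ∃ l r, r ≠ 0 ∧ c = mk l r := by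
  induction c using Quotient.inductionOn with
  | h p =>
    rcases p with _ | ⟨l, r⟩
    · exact Or.inl rfl
    · by_cases hr : r = 0
      · exact Or.inl (mk_eq_vertex_iff.2 hr)
      · exact Or.inr ⟨l, r, hr, rfl⟩

end OpenCone

/-! ### Charts at singular strata and their unfoldings -/

section Charts

variable {n : ℕ} {X : Type u} [TopologicalSpace X] {D : SimpleSpace n X}

theorem SimpleSpace.notMem_reg_of_mem_stratum {s : D.Strata} {x : X} (hx : x ∈ D.stratum s) :
    x ∉ D.reg := by
  obtain ⟨y, -, rfl⟩ := hx
  exact y.2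

namespace PemChart

variable {s : D.Strata} {L : CompactManifold.{v}} (a : PemChart D s L)

theorem mk_mem_reg (u : a.U) (l : L.carrier) {r : ℝ≥0} (hr : r ≠ 0) :
    a.toFun (u, OpenCone.mk l r) ∈ D.reg := by
  have h := a.mem_reg u l ⟨(r : ℝ), NNReal.coe_pos.2 (pos_iff_ne_zero.2 hr)⟩
  simpa using h

theorem eq_of_mk_eq_mk {u u' : a.U} {l l' : L.carrier} {r r' : ℝ≥0} (hr : r ≠ 0)
    (h : a.toFun (u, OpenCone.mk l r) = a.toFun (u', OpenCone.mk l' r')) :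
    u = u' ∧ l = l' ∧ r = r' := by
  obtain ⟨h1, h2⟩ := Prod.ext_iff.1 (a.isOpenEmbedding.injective h)
  rcases OpenCone.mk_eq_mk_iff.1 h2 with h2 | h2
  · exact ⟨h1, h2⟩
  · exact (hr h2.1).elim

theorem exists_eq_of_mem_range {x : X} (hx : x ∈ range a.toFun) (hreg : x ∉ D.reg) :
    ∃ u : a.U, x = ((u : D.stratum s) : X) := by
  obtain ⟨⟨u, c⟩, rfl⟩ := hx
  rcases OpenCone.eq_vertex_or_eq_mk c with rfl | ⟨l, r, hr, rfl⟩
  · exact ⟨u, a.apply_vertex u⟩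
  · exact (hreg (a.mk_mem_reg u l hr)).elim

/-- The range of `αt` is the whole preimage of the chart, so points over it differ only in the sign
of `t`. This leaves a sign as the only choice for a local lifting. -/
theorem eq_or_eq_neg_of_apply_eq {Y : Type*} {𝓛 : Y → X} {αt : a.U × L.carrier × ℝ → Y}
    (hrange : range αt = 𝓛 ⁻¹' range a.toFun)
    (hαt : ∀ u l t, 𝓛 (αt (u, l, t)) = a.toFun (u, OpenCone.mk l (Real.nnabs t)))
    {w : Y} {u : a.U} {l : L.carrier} {t : ℝ} (ht : t ≠ 0)
    (hw : 𝓛 w = a.toFun (u, OpenCone.mk l (Real.nnabs t))) :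
    w = αt (u, l, t) ∨ w = αt (u, l, -t) := by
  obtain ⟨⟨u', l', t'⟩, rfl⟩ : w ∈ range αt := by
    rw [hrange]
    exact ⟨_, hw.symm⟩
  rw [hαt] at hw
  obtain ⟨rfl, rfl, h⟩ := a.eq_of_mk_eq_mk (by simpa using ht) hw.symm
  have h' : |t| = |t'| := by simpa using congrArg NNReal.toReal h
  rcases abs_eq_abs.1 h' with rfl | rfl
  · exact Or.inl rfl
  · exact Or.inr (by rw [neg_neg])

theorem exists_eq_apply_zero {Y : Type*} {𝓛 : Y → X} {a : PemChart D s L}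
    {αt : a.U × L.carrier × ℝ → Y}
    (hrange : range αt = 𝓛 ⁻¹' range a.toFun)
    (hαt : ∀ u l t, 𝓛 (αt (u, l, t)) = a.toFun (u, OpenCone.mk l (Real.nnabs t)))
    {z : Y} (u : a.U) (hz : ((u : D.stratum s) : X) = 𝓛 z) : ∃ l, z = αt (u, l, 0) := by
  obtain ⟨⟨u', l, t⟩, rfl⟩ : z ∈ range αt := by
    rw [hrange]
    exact ⟨(u, OpenCone.vertex _), by rw [a.apply_vertex, hz]⟩
  rw [hαt, ← a.apply_vertex] at hz
  obtain ⟨h1, h2⟩ := Prod.ext_iff.1 (a.isOpenEmbedding.injective hz)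
  obtain rfl : u = u' := h1
  have ht : t = 0 := by simpa using OpenCone.mk_eq_vertex_iff.1 h2.symm
  exact ⟨l, by rw [ht]⟩

theorem apply_mem_reg_of_ne_zero {Y : Type*} {𝓛 : Y → X} {a : PemChart D s L}
    {αt : a.U × L.carrier × ℝ → Y}
    (hαt : ∀ u l t, 𝓛 (αt (u, l, t)) = a.toFun (u, OpenCone.mk l (Real.nnabs t)))
    (u : a.U) (l : L.carrier) {t : ℝ} (ht : t ≠ 0) : 𝓛 (αt (u, l, t)) ∈ D.reg := by
  rw [hαt]
  exact a.mk_mem_reg u l (by simpa using ht)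

end PemChart

end Charts

/-! ### Bubbles as connected components -/

section Bubbles

variable {n : ℕ} {X : Type u} [TopologicalSpace X] {D : SimpleSpace n X}
  {Y : Type*} [TopologicalSpace Y] {𝓛 : Y → X}

theorem bubbleSet_subset (b : Bubble D 𝓛) : bubbleSet D 𝓛 b ⊆ 𝓛 ⁻¹' (D.reg : Set X) := by
  rintro _ ⟨z, -, rfl⟩
  exact z.2

theorem mk_mem_bubbleSet_iff (z : ↥(𝓛 ⁻¹' (D.reg : Set X))) (b : Bubble D 𝓛) :
    (z : Y) ∈ bubbleSet D 𝓛 b ↔ ConnectedComponents.mk z = b := by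
  constructor
  · rintro ⟨z', hz', h⟩
    rwa [← Subtype.ext h]
  · exact fun h => ⟨z, h, rfl⟩

theorem exists_mem_bubbleSet {y : Y} (hy : 𝓛 y ∈ D.reg) : ∃ b, y ∈ bubbleSet D 𝓛 b :=
  ⟨_, (mk_mem_bubbleSet_iff ⟨y, hy⟩ _).2 rfl⟩

theorem eq_of_mem_bubbleSet {y : Y} {b c : Bubble D 𝓛} (hb : y ∈ bubbleSet D 𝓛 b)
    (hc : y ∈ bubbleSet D 𝓛 c) : b = c := by
  have hy := bubbleSet_subset b hb
  exact ((mk_mem_bubbleSet_iff ⟨y, hy⟩ _).1 hb).symm.trans ((mk_mem_bubbleSet_iff ⟨y, hy⟩ _).1 hc)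

theorem isPreconnected_bubbleSet (b : Bubble D 𝓛) : IsPreconnected (bubbleSet D 𝓛 b) := by
  obtain ⟨z, rfl⟩ := ConnectedComponents.surjective_coe b
  have : {x : ↥(𝓛 ⁻¹' (D.reg : Set X)) | ConnectedComponents.mk x = ConnectedComponents.mk z} =
      connectedComponent z := by
    ext x
    exact ConnectedComponents.coe_eq_coe'
  rw [bubbleSet, this]
  exact isPreconnected_connectedComponent.image _ continuous_subtype_val.continuousOn

theorem IsPreconnected.subset_bubbleSet {C : Set Y} (hC : IsPreconnected C)
    (hreg : C ⊆ 𝓛 ⁻¹' (D.reg : Set X)) {y : Y} (hy : y ∈ C) {b : Bubble D 𝓛}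
    (hb : y ∈ bubbleSet D 𝓛 b) : C ⊆ bubbleSet D 𝓛 b := by
  intro x hx
  have hC' : IsPreconnected (Subtype.val ⁻¹' C : Set ↥(𝓛 ⁻¹' (D.reg : Set X))) := by
    rw [← Topology.IsInducing.subtypeVal.isPreconnected_image,
      Subtype.image_preimage_coe, inter_eq_right.2 hreg]
    exact hC
  obtain rfl := (mk_mem_bubbleSet_iff ⟨y, hreg hy⟩ _).1 hb
  refine (mk_mem_bubbleSet_iff ⟨x, hreg hx⟩ _).2 (ConnectedComponents.coe_eq_coe'.2 ?_)
  exact hC'.subset_connectedComponent (mem_preimage.2 (show _ ∈ C from hy))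
    (mem_preimage.2 (show _ ∈ C from hx))

end Bubbles

/-! ### The copies of the regular part -/

section Unfoldings

variable {n k : ℕ} {X : Type u} [TopologicalSpace X] {D : SimpleSpace n X}
  {Y : Type*} [TopologicalSpace Y] [ChartedSpace (EuclideanSpace ℝ (Fin n)) Y] {𝓛 : Y → X}

/-- The copies are open and disjoint, so the connected bubble lies in a single one, where `𝓛` is a
diffeomorphism onto the regular part. -/
theorem IsUnfolding.injOn_bubbleSet (h𝓛 : IsUnfolding.{u, v} D k 𝓛) (b : Bubble D 𝓛) :
    InjOn 𝓛 (bubbleSet D 𝓛 b) := by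
  obtain ⟨B, hdisj, hunion, hB⟩ := h𝓛.covering
  intro y hy z hz hyz
  obtain ⟨i, hi⟩ : ∃ i, y ∈ B i := by
    have := bubbleSet_subset b hy
    rw [← hunion] at this
    simpa using this
  have hsub : bubbleSet D 𝓛 b ⊆ B i := by
    refine (isPreconnected_bubbleSet b).subset_left_of_subset_union (B i).isOpen
      (isOpen_iUnion fun j => isOpen_iUnion fun _ : i ≠ j => (B j).isOpen)
      (disjoint_iUnion₂_right.2 fun j hj => hdisj hj) ?_ ⟨y, hy, hi⟩
    refine (bubbleSet_subset b).trans ?_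
    rw [← hunion]
    refine iUnion_subset fun j => ?_
    by_cases hij : i = j
    · subst hij
      exact subset_union_left
    · exact (subset_iUnion₂ (s := fun j (_ : i ≠ j) => (B j : Set Y)) j hij).trans
        subset_union_right
  obtain ⟨φ, hφ⟩ := hB i
  have : φ ⟨y, hsub hy⟩ = φ ⟨z, hsub hz⟩ := Subtype.ext (by rw [hφ, hφ]; exact hyz)
  exact congrArg Subtype.val (φ.injective this)

/-- A proper map has closed image, and this image contains the dense regular part. -/
theorem IsUnfolding.surjective (h𝓛 : IsUnfolding.{u, v} D k 𝓛) : Function.Surjective 𝓛 := by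
  obtain ⟨B, -, -, hB⟩ := h𝓛.covering
  obtain ⟨φ, hφ⟩ := hB ⟨0, h𝓛.pos⟩
  have hsub : (D.reg : Set X) ⊆ range 𝓛 := fun x hx =>
    ⟨φ.symm ⟨x, hx⟩, by rw [← hφ, φ.apply_symm_apply]⟩
  rw [← range_eq_univ, ← h𝓛.proper.isClosedMap.isClosed_range.closure_eq]
  exact (D.dense_reg.mono hsub).closure_eq

theorem IsUnfolding.exists_homeomorph (h𝓛 : IsUnfolding.{u, v} D k 𝓛) :
    ∃ ψ : Fin k × D.reg ≃ₜ ↥(𝓛 ⁻¹' (D.reg : Set X)), ∀ p, 𝓛 (ψ p) = p.2 := by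
  obtain ⟨B, hdisj, hunion, hB⟩ := h𝓛.covering
  choose φ hφ using hB
  have hval : ∀ i (x : D.reg), 𝓛 ((φ i).symm x) = x := fun i x => by
    rw [← hφ, (φ i).apply_symm_apply]
  let ψ : Fin k × D.reg → ↥(𝓛 ⁻¹' (D.reg : Set X)) := fun p =>
    ⟨(φ p.1).symm p.2, by simp [hval]⟩
  have hcont : Continuous ψ := by
    refine Continuous.subtype_mk (continuous_prod_of_discrete_left.2 fun i => ?_) _
    exact continuous_subtype_val.comp (φ i).symm.continuous
  have hopen : IsOpenMap ψ := by
    refine isOpenMap_prod_of_discrete_left.2 fun i => ?_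
    refine IsOpenMap.subtype_mk
      ((B i).isOpenEmbedding'.isOpenMap.comp (φ i).symm.toHomeomorph.isOpenMap) _
  have hbij : Function.Bijective ψ := by
    constructor
    · rintro ⟨i, x⟩ ⟨j, y⟩ h
      have h' : (((φ i).symm x : B i) : Y) = (φ j).symm y := congrArg Subtype.val h
      have hij : i = j := by
        by_contra hij
        exact (hdisj hij).ne_of_mem ((φ i).symm x).2 ((φ j).symm y).2 h'
      have hxy : x = y := Subtype.ext (by rw [← hval i x, ← hval j y, h'])
      rw [hij, hxy]
    · rintro ⟨z, hz⟩
      obtain ⟨i, hi⟩ : ∃ i, z ∈ B i := by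
        rw [← hunion] at hz
        simpa using hz
      exact ⟨(i, φ i ⟨z, hi⟩), Subtype.ext (by simp [ψ])⟩
  exact ⟨(Equiv.ofBijective ψ hbij).toHomeomorphOfContinuousOpen hcont hopen,
    fun p => hval p.1 p.2⟩

end Unfoldings

/-! ### Existence and inversion of bubble permutations -/

section Permutations

variable {n n' k : ℕ} {X : Type u} {X' : Type w} [TopologicalSpace X] [TopologicalSpace X']
  {D : SimpleSpace n X} {D' : SimpleSpace n' X'}
  {Y Y' : Type*} [TopologicalSpace Y] [TopologicalSpace Y'] {𝓛 : Y → X} {𝓛' : Y' → X'}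

theorem IsThomMatherIso.symm {𝒯 : ThomMather.{u, v} D} {𝒯' : ThomMather.{w, v} D'} {f : X ≃ₜ X'}
    (hf : IsThomMatherIso 𝒯 𝒯' f) : IsThomMatherIso 𝒯' 𝒯 f.symm :=
  ⟨hf.2, by rw [Homeomorph.symm_symm]; exact hf.1⟩

theorem IsThomMatherIso.apply_mem_reg_iff {𝒯 : ThomMather.{u, v} D} {𝒯' : ThomMather.{w, v} D'}
    {f : X ≃ₜ X'} (hf : IsThomMatherIso 𝒯 𝒯' f) {x : X} : f x ∈ D'.reg ↔ x ∈ D.reg := by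
  constructor
  · intro h
    obtain ⟨hm, -⟩ := hf.2.morphism.smooth_reg
    simpa using hm h
  · intro h
    obtain ⟨hm, -⟩ := hf.1.morphism.smooth_reg
    exact hm h

/-- The bijection between the sets of connected components induced by a homeomorphism. -/
def Homeomorph.connectedComponentsCongr {A B : Type*} [TopologicalSpace A] [TopologicalSpace B]
    (Φ : A ≃ₜ B) : ConnectedComponents A ≃ ConnectedComponents B where
  toFun := Φ.continuous.connectedComponentsMap
  invFun := Φ.symm.continuous.connectedComponentsMap
  left_inv c := by
    obtain ⟨z, rfl⟩ := ConnectedComponents.surjective_coe c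
    simp
  right_inv c := by
    obtain ⟨z, rfl⟩ := ConnectedComponents.surjective_coe c
    simp

theorem isBubblePermutation_connectedComponentsCongr {f : X → X'}
    (Φ : ↥(𝓛 ⁻¹' (D.reg : Set X)) ≃ₜ ↥(𝓛' ⁻¹' (D'.reg : Set X')))
    (hΦ : ∀ z, 𝓛' (Φ z) = f (𝓛 z)) :
    IsBubblePermutation D D' 𝓛 𝓛' f Φ.connectedComponentsCongr := by
  intro b
  have key : ∀ z, ConnectedComponents.mk (Φ z) = Φ.connectedComponentsCongr b ↔
      ConnectedComponents.mk z = b := fun z =>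
    (Φ.connectedComponentsCongr).injective.eq_iff (a := ConnectedComponents.mk z)
  ext x
  simp only [bubbleSet, image_image, mem_image, mem_ofPred_eq]
  constructor
  · rintro ⟨z, hz, rfl⟩
    refine ⟨Φ.symm z, (key _).1 (by simpa using hz), ?_⟩
    rw [← hΦ, Φ.apply_symm_apply]
  · rintro ⟨z, hz, rfl⟩
    exact ⟨Φ z, (key z).2 hz, hΦ z⟩

theorem IsBubblePermutation.symm {f : X ≃ₜ X'} {σ : Bubble D 𝓛 ≃ Bubble D' 𝓛'}
    (hσ : IsBubblePermutation D D' 𝓛 𝓛' f σ) :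
    IsBubblePermutation D' D 𝓛' 𝓛 f.symm σ.symm := by
  intro b
  have h := hσ (σ.symm b)
  rw [σ.apply_symm_apply] at h
  rw [h, ← image_comp f.symm f]
  simp

theorem exists_isBubblePermutation
    [ChartedSpace (EuclideanSpace ℝ (Fin n)) Y] [ChartedSpace (EuclideanSpace ℝ (Fin n')) Y']
    (h𝓛 : IsUnfolding.{u, v} D k 𝓛) (h𝓛' : IsUnfolding.{w, v} D' k 𝓛') (f : X ≃ₜ X')
    (hreg : ∀ x, f x ∈ D'.reg ↔ x ∈ D.reg) :
    ∃ σ : Bubble D 𝓛 ≃ Bubble D' 𝓛', IsBubblePermutation D D' 𝓛 𝓛' f σ := by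
  obtain ⟨ψ, hψ⟩ := h𝓛.exists_homeomorph
  obtain ⟨ψ', hψ'⟩ := h𝓛'.exists_homeomorph
  let fR : D.reg ≃ₜ D'.reg := f.subtype fun x => (hreg x).symm
  -- The permutation is induced by `id × f` on `Fin k × reg`; this is where the equal number of
  -- copies enters.
  refine ⟨_, isBubblePermutation_connectedComponentsCongr
    ((ψ.symm.trans ((Homeomorph.refl (Fin k)).prodCongr fR)).trans ψ') fun z => ?_⟩
  obtain ⟨p, rfl⟩ := ψ.surjective z
  simp [hψ, hψ', fR]

end Permutations

/-! ### Pointwise liftings -/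

section Liftings

variable {n n' k : ℕ} {X : Type u} {X' : Type w} [TopologicalSpace X] [TopologicalSpace X']
  {D : SimpleSpace n X} {D' : SimpleSpace n' X'}
  {Y Y' : Type*} [TopologicalSpace Y] [TopologicalSpace Y'] {𝓛 : Y → X} {𝓛' : Y' → X'}

/-- The point `y'` lies over `f (𝓛 y)`, in the bubble `σ b` if `y` lies in the bubble `b`. -/
structure IsPointLift (f : X → X') (σ : Bubble D 𝓛 ≃ Bubble D' 𝓛') (y : Y) (y' : Y') : Prop where
  comm : 𝓛' y' = f (𝓛 y)
  mem : ∀ b, y ∈ bubbleSet D 𝓛 b → y' ∈ bubbleSet D' 𝓛' (σ b)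

theorem IsLifting.isPointLift {f : X → X'} {σ : Bubble D 𝓛 ≃ Bubble D' 𝓛'} {F : Y → Y'}
    (hF : IsLifting D D' 𝓛 𝓛' f σ F) (y : Y) : IsPointLift f σ y (F y) :=
  ⟨hF.comm y, fun b hb => hF.mapsTo b hb⟩

theorem IsPointLift.unique [ChartedSpace (EuclideanSpace ℝ (Fin n')) Y']
    (h𝓛' : IsUnfolding.{w, v} D' k 𝓛') {f : X → X'}
    {σ : Bubble D 𝓛 ≃ Bubble D' 𝓛'} {y : Y} (hy : 𝓛 y ∈ D.reg) {y₁ y₂ : Y'}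
    (h₁ : IsPointLift f σ y y₁) (h₂ : IsPointLift f σ y y₂) : y₁ = y₂ := by
  obtain ⟨b, hb⟩ := exists_mem_bubbleSet hy
  exact h𝓛'.injOn_bubbleSet _ (h₁.mem b hb) (h₂.mem b hb) (h₁.comm.trans h₂.comm.symm)

theorem IsBubblePermutation.exists_isPointLift {f : X → X'} {σ : Bubble D 𝓛 ≃ Bubble D' 𝓛'}
    (hσ : IsBubblePermutation D D' 𝓛 𝓛' f σ) {y : Y} (hy : 𝓛 y ∈ D.reg) :
    ∃ y', IsPointLift f σ y y' := by
  obtain ⟨b, hb⟩ := exists_mem_bubbleSet hy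
  have h : f (𝓛 y) ∈ 𝓛' '' bubbleSet D' 𝓛' (σ b) := by
    rw [hσ b]
    exact mem_image_of_mem f (mem_image_of_mem 𝓛 hb)
  obtain ⟨y', hy', h⟩ := h
  refine ⟨y', h, fun c hc => ?_⟩
  rwa [eq_of_mem_bubbleSet hc hb]

/-- The images of `C` under `p` and `q` are connected and lie over the regular parts, so each stays
in one bubble; the bubble condition at `x₀` therefore holds on all of `C`. -/
theorem IsPointLift.of_isPreconnected {f : X → X'} {σ : Bubble D 𝓛 ≃ Bubble D' 𝓛'}
    (hreg : ∀ x, x ∈ D.reg → f x ∈ D'.reg)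
    {P : Type*} [TopologicalSpace P] {C : Set P} (hC : IsPreconnected C) {p : P → Y} {q : P → Y'}
    (hp : ContinuousOn p C) (hq : ContinuousOn q C) (hpreg : ∀ x ∈ C, 𝓛 (p x) ∈ D.reg)
    (hpq : ∀ x ∈ C, 𝓛' (q x) = f (𝓛 (p x))) {x₀ : P} (hx₀ : x₀ ∈ C)
    (h₀ : IsPointLift f σ (p x₀) (q x₀)) {x : P} (hx : x ∈ C) : IsPointLift f σ (p x) (q x) := by
  refine ⟨hpq x hx, fun b hb => ?_⟩
  have hpC : p '' C ⊆ bubbleSet D 𝓛 b :=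
    IsPreconnected.subset_bubbleSet (hC.image p hp) (image_subset_iff.2 hpreg)
      (mem_image_of_mem p hx) hb
  have hqC : q '' C ⊆ bubbleSet D' 𝓛' (σ b) := by
    refine IsPreconnected.subset_bubbleSet (hC.image q hq) (image_subset_iff.2 fun y hy => ?_)
      (mem_image_of_mem q hx₀) (h₀.mem b (hpC (mem_image_of_mem p hx₀)))
    change 𝓛' (q y) ∈ D'.reg
    rw [hpq y hy]
    exact hreg _ (hpreg y hy)
  exact hqC (mem_image_of_mem q hx)

/-- Equal lifts of `y₁` and `y₂` would put both points in one bubble, since `σ` is injective, and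
there `𝓛` separates them. So the two lifts are `q 1` and `q (-1)` in some order. -/
theorem IsPointLift.exists_sign [ChartedSpace (EuclideanSpace ℝ (Fin n)) Y]
    (h𝓛 : IsUnfolding.{u, v} D k 𝓛) {f : X → X'} {σ : Bubble D 𝓛 ≃ Bubble D' 𝓛'}
    (hσ : IsBubblePermutation D D' 𝓛 𝓛' f σ) {y₁ y₂ : Y} (hne : y₁ ≠ y₂)
    (h : 𝓛 y₁ = 𝓛 y₂) (hreg : 𝓛 y₁ ∈ D.reg) {q : ℝ → Y'}
    (hq : ∀ w, 𝓛' w = f (𝓛 y₁) → w = q 1 ∨ w = q (-1)) :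
    ∃ ε : ℝ, (ε = 1 ∨ ε = -1) ∧ IsPointLift f σ y₁ (q ε) ∧ IsPointLift f σ y₂ (q (-ε)) := by
  obtain ⟨w₁, hw₁⟩ := hσ.exists_isPointLift hreg
  obtain ⟨w₂, hw₂⟩ := hσ.exists_isPointLift (h ▸ hreg)
  have hw : w₁ ≠ w₂ := by
    rintro rfl
    obtain ⟨b, hb⟩ := exists_mem_bubbleSet hreg
    obtain ⟨c, hc⟩ := exists_mem_bubbleSet (h ▸ hreg)
    obtain rfl : b = c := σ.injective (eq_of_mem_bubbleSet (hw₁.mem b hb) (hw₂.mem c hc))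
    exact hne (h𝓛.injOn_bubbleSet b hb hc h)
  rcases hq w₁ hw₁.comm with rfl | rfl <;> rcases hq w₂ (h ▸ hw₂.comm) with rfl | rfl
  · exact (hw rfl).elim
  · exact ⟨1, Or.inl rfl, hw₁, hw₂⟩
  · exact ⟨-1, Or.inr rfl, hw₁, by rwa [neg_neg]⟩
  · exact (hw rfl).elim

end Liftings

/-! ### Smooth local liftings over the regular part, and smoothness along the links -/

section LocalLiftings

variable {n n' k : ℕ} {X : Type u} {X' : Type w} [TopologicalSpace X] [TopologicalSpace X']
  {D : SimpleSpace n X} {D' : SimpleSpace n' X'}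
  {𝒯 : ThomMather.{u, v} D} {𝒯' : ThomMather.{w, v} D'}
  {Y Y' : Type*} [TopologicalSpace Y] [TopologicalSpace Y']
  [ChartedSpace (EuclideanSpace ℝ (Fin n)) Y] [ChartedSpace (EuclideanSpace ℝ (Fin n')) Y']
  {𝓛 : Y → X} {𝓛' : Y' → X'}

/-- Near a point over the regular part, an isomorphism lifts smoothly. -/
theorem exists_smooth_pointLift_of_mem_reg (h𝓛 : IsUnfolding.{u, v} D k 𝓛)
    (h𝓛' : IsUnfolding.{w, v} D' k 𝓛') {f : X → X'} (hf : IsSimpleMorphism D D' f)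
    {σ : Bubble D 𝓛 ≃ Bubble D' 𝓛'} (hσ : IsBubblePermutation D D' 𝓛 𝓛' f σ)
    {z : Y} (hz : 𝓛 z ∈ D.reg) :
    ∃ H : Y → Y', ∀ᶠ y in nhds z, ContMDiffAt (𝓡 n) (𝓡 n') ∞ H y ∧
      (𝓛 y ∈ D.reg → IsPointLift f σ y (H y)) := by
  classical
  have : LocallyConnectedSpace Y :=
    ChartedSpace.locallyConnectedSpace (EuclideanSpace ℝ (Fin n)) Y
  obtain ⟨hfreg, hfsmooth⟩ := hf.smooth_reg
  obtain ⟨z', hz'⟩ := hσ.exists_isPointLift hz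
  obtain ⟨B, -, hunion, hB⟩ := h𝓛.covering
  obtain ⟨B', -, hunion', hB'⟩ := h𝓛'.covering
  obtain ⟨i, hi⟩ : ∃ i, z ∈ B i := by
    have : z ∈ 𝓛 ⁻¹' (D.reg : Set X) := hz
    rw [← hunion] at this
    simpa using this
  obtain ⟨j, hj⟩ : ∃ j, z' ∈ B' j := by
    have : z' ∈ 𝓛' ⁻¹' (D'.reg : Set X') := by
      change 𝓛' z' ∈ D'.reg
      rw [hz'.comm]
      exact hfreg hz
    rw [← hunion'] at this
    simpa using this
  obtain ⟨φ, hφ⟩ := hB i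
  obtain ⟨φ', hφ'⟩ := hB' j
  let h : B i → Y' := fun y => φ'.symm ⟨f (φ y), hfreg (φ y).2⟩
  have hh : ContMDiff (𝓡 n) (𝓡 n') ∞ h :=
    contMDiff_subtype_val.comp (φ'.symm.contMDiff.comp (hfsmooth.comp φ.contMDiff))
  let H : Y → Y' := fun y => if hy : y ∈ B i then h ⟨y, hy⟩ else z'
  have hH : ∀ y : B i, H y = h y := fun y => dif_pos y.2
  have hHsmooth : ∀ y ∈ B i, ContMDiffAt (𝓡 n) (𝓡 n') ∞ H y := fun y hy => by
    refine contMDiffAt_subtype_iff.1 (?_ : ContMDiffAt _ _ _ _ (⟨y, hy⟩ : B i))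
    simp only [hH]
    exact hh _
  have hHcomm : ∀ y ∈ B i, 𝓛' (H y) = f (𝓛 y) := fun y hy => by
    rw [hH ⟨y, hy⟩, ← hφ', φ'.apply_symm_apply]
    exact congrArg f (hφ _)
  have hHz : H z = z' := by
    rw [hH ⟨z, hi⟩]
    have : (⟨f (φ ⟨z, hi⟩), hfreg (φ ⟨z, hi⟩).2⟩ : D'.reg) = φ' ⟨z', hj⟩ :=
      Subtype.ext (by rw [hφ', hz'.comm]; exact congrArg f (hφ _))
    simp only [h, this, φ'.symm_apply_apply]
  obtain ⟨N, hN, hNo, hzN, hNc⟩ := locallyConnectedSpace_iff_subsets_isOpen_isConnected.1 this z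
    (B i) ((B i).isOpen.mem_nhds hi)
  refine ⟨H, Filter.mem_of_superset (hNo.mem_nhds hzN) fun y hy => ⟨hHsmooth y (hN hy), fun _ => ?_⟩⟩
  refine IsPointLift.of_isPreconnected hfreg hNc.isPreconnected (p := id) continuousOn_id
    (fun y hy => (hHsmooth y (hN hy)).continuousAt.continuousWithinAt) (fun y hy => ?_)
    (fun y hy => hHcomm y (hN hy)) hzN ?_ hy
  · have : y ∈ 𝓛 ⁻¹' (D.reg : Set X) := by
      rw [← hunion]
      exact mem_iUnion_of_mem i (hN hy)
    exact this
  · rwa [hHz]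

/-- In bundle charts, a Thom–Mather isomorphism is smooth in the stratum and the link jointly. -/
theorem IsThomMatherMorphism.exists_smooth_on_links {f : X ≃ₜ X'}
    (hf : IsThomMatherMorphism 𝒯 𝒯' f) (hreg : ∀ x, f x ∈ D'.reg ↔ x ∈ D.reg)
    {s : D.Strata} {s' : D'.Strata} {a : PemChart D s (𝒯 s).link} (ha : a ∈ (𝒯 s).atlas)
    {a' : PemChart D' s' (𝒯' s').link} (ha' : a' ∈ (𝒯' s').atlas) {u₀ : a.U} {u₀' : a'.U}
    (hu₀ : f ((u₀ : D.stratum s) : X) = ((u₀' : D'.stratum s') : X')) (l₀ : (𝒯 s).link.carrier) :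
    ∃ Θ : a.U × (𝒯 s).link.carrier → a'.U × (𝒯' s').link.carrier,
      ∀ᶠ p in nhds (u₀, l₀),
        ContMDiffAt ((𝓡 (D.dim s)).prod (𝓡 (𝒯 s).link.dim))
          ((𝓡 (D'.dim s')).prod (𝓡 (𝒯' s').link.dim)) ∞ Θ p ∧
        ∀ r : ℝ≥0, f (a.toFun (p.1, OpenCone.mk p.2 r)) =
          a'.toFun ((Θ p).1, OpenCone.mk (Θ p).2 r) := by
  classical
  let Q : Set (a.U × (𝒯 s).link.carrier) := {p | f ((p.1 : D.stratum s) : X) ∈ range a'.toFun}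
  have hQo : IsOpen Q := a'.isOpenEmbedding.isOpen_range.preimage (by fun_prop)
  have hQ₀ : (u₀, l₀) ∈ Q := ⟨(u₀', OpenCone.vertex _), by rw [a'.apply_vertex, hu₀]⟩
  have hex : ∀ p : a.U × (𝒯 s).link.carrier, ∃ q : a'.U × (𝒯' s').link.carrier, p ∈ Q →
      ∀ r : ℝ≥0, f (a.toFun (p.1, OpenCone.mk p.2 r)) =
        a'.toFun (q.1, OpenCone.mk q.2 r) := by
    rintro ⟨u, l⟩
    by_cases hp : (u, l) ∈ Q
    · obtain ⟨u', hu'⟩ := a'.exists_eq_of_mem_range hp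
        (by rw [hreg]; exact D.notMem_reg_of_mem_stratum u.1.2)
      obtain ⟨g, -, hg⟩ := hf.preserves_tube s s' a ha a' ha' u u' hu'
      exact ⟨(u', g l), fun _ => hg l⟩
    -- Outside `Q` the value is irrelevant; `g l₀` only supplies some point of the target link.
    · obtain ⟨g, -, -⟩ := hf.preserves_tube s s' a ha a' ha' u₀ u₀' hu₀
      exact ⟨(u₀', g l₀), fun h => (hp h).elim⟩
  choose Θ hΘ using hex
  refine ⟨Θ, Filter.mem_of_superset (hQo.mem_nhds hQ₀) fun p hp => ⟨?_, hΘ p hp⟩⟩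
  obtain ⟨hfreg, hfsmooth⟩ := hf.morphism.smooth_reg
  let one : posReal := ⟨1, mem_Ioi.2 one_pos⟩
  have hone : Real.toNNReal (one : ℝ) = 1 := Real.toNNReal_one
  let β : a.U × (𝒯 s).link.carrier → D'.reg := fun q =>
    ⟨f (a.toFun (q.1, OpenCone.mk q.2 (Real.toNNReal one))), hfreg (a.mem_reg q.1 q.2 one)⟩
  have hβ : ContMDiff ((𝓡 (D.dim s)).prod (𝓡 (𝒯 s).link.dim)) (𝓡 n') ∞ β :=
    (hfsmooth.comp a.diffeo_reg.contMDiff).comp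
      (contMDiff_fst.prodMk (contMDiff_snd.prodMk contMDiff_const) :
        ContMDiff ((𝓡 (D.dim s)).prod (𝓡 (𝒯 s).link.dim)) (pemModel (D.dim s) (𝒯 s).link.dim) ∞
          fun q : a.U × (𝒯 s).link.carrier => (q.1, q.2, one))
  obtain ⟨Ψ, hΨ, hΨeq⟩ := a'.diffeo_reg ((Θ p).1, (Θ p).2, one)
  have hβp : β p = Ψ ((Θ p).1, (Θ p).2, one) := by
    rw [← hΨeq hΨ]
    exact Subtype.ext (hΘ p hp _)
  have hmem : β p ∈ Ψ.target := hβp ▸ Ψ.map_source hΨ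
  have hsmooth : ContMDiffAt ((𝓡 (D.dim s)).prod (𝓡 (𝒯 s).link.dim))
      (pemModel (D'.dim s') (𝒯' s').link.dim) ∞ (fun q => Ψ.symm (β q)) p :=
    (Ψ.symm.contMDiffOn.contMDiffAt (Ψ.open_target.mem_nhds hmem)).comp p hβ.contMDiffAt
  -- Continuity of `Θ` is not yet known, so `(Θ q, 1)` cannot be assumed to lie in the source of
  -- `Ψ`. Injectivity of the whole chart `a'` at positive radius identifies it with `Ψ.symm (β q)`.
  have hev : ∀ᶠ q in nhds p, Ψ.symm (β q) = ((Θ q).1, (Θ q).2, one) := by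
    filter_upwards [hQo.mem_nhds hp,
      hβ.continuous.continuousAt.preimage_mem_nhds (Ψ.open_target.mem_nhds hmem)] with q hq hq'
    have h1 := Ψ.right_inv hq'
    have h2 := hΨeq (Ψ.map_target hq')
    have h3 := congrArg Subtype.val (h2.trans h1)
    obtain ⟨h4, h5, h6⟩ := a'.eq_of_mk_eq_mk
      (Real.toNNReal_pos.2 (Ψ.invFun (β q)).2.2.2).ne' (h3.trans (hΘ q hq _))
    refine Prod.ext h4 (Prod.ext h5 (Subtype.ext ?_))
    exact (Real.toNNReal_eq_toNNReal_iff (Ψ.invFun (β q)).2.2.2.le one.2.le).1 h6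
  have : ContMDiffAt ((𝓡 (D.dim s)).prod (𝓡 (𝒯 s).link.dim))
      ((𝓡 (D'.dim s')).prod (𝓡 (𝒯' s').link.dim)) ∞
      (fun q => ((Ψ.symm (β q)).1, (Ψ.symm (β q)).2.1)) p :=
    hsmooth.fst.prodMk hsmooth.snd.fst
  refine this.congr_of_eventuallyEq ?_
  filter_upwards [hev] with q hq
  rw [hq]

end LocalLiftings

/-! ### Liftings across the singular part, gluing and uniqueness -/

section Extension

variable {n n' k : ℕ} {X : Type u} {X' : Type w} [TopologicalSpace X] [TopologicalSpace X']
  {D : SimpleSpace n X} {D' : SimpleSpace n' X'}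
  {𝒯 : ThomMather.{u, v} D} {𝒯' : ThomMather.{w, v} D'}
  {Y Y' : Type*} [TopologicalSpace Y] [TopologicalSpace Y']
  [ChartedSpace (EuclideanSpace ℝ (Fin n)) Y] [ChartedSpace (EuclideanSpace ℝ (Fin n')) Y']
  {𝓛 : Y → X} {𝓛' : Y' → X'}

/-- A point over the singular part is some `αt (u, l, 0)`, the limit of `αt (u, l, t)` as `t → 0`
with `t ≠ 0`. -/
theorem IsAdapted.dense_preimage_reg (hA : IsAdapted 𝒯 𝓛) :
    Dense (𝓛 ⁻¹' (D.reg : Set X)) := by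
  intro z
  by_cases hz : 𝓛 z ∈ D.reg
  · exact subset_closure hz
  obtain ⟨s, a, -, ⟨u', hu', hu⟩, αt, hαtd, -, hrange, hαt⟩ := hA z hz
  obtain ⟨l, rfl⟩ := PemChart.exists_eq_apply_zero hrange hαt ⟨u', hu'⟩ hu
  have hcont : Continuous fun t : ℝ => αt (⟨u', hu'⟩, l, t) :=
    hαtd.contMDiff.continuous.comp (by fun_prop)
  have h0 : (0 : ℝ) ∈ closure {(0 : ℝ)}ᶜ := by simp
  exact map_mem_closure (f := fun t : ℝ => αt (⟨u', hu'⟩, l, t)) hcont h0 fun t ht => PemChart.apply_mem_reg_of_ne_zero hαt _ l ht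

/-- Near a point over the singular part, an isomorphism lifts smoothly: in unfolded bundle charts
the lifting is `(u, l, t) ↦ (f u, g(u)(l), ±t)`, with a locally constant sign. -/
theorem exists_smooth_pointLift_of_notMem_reg (h𝓛 : IsUnfolding.{u, v} D k 𝓛)
    (hA : IsAdapted 𝒯 𝓛) (h𝓛' : IsUnfolding.{w, v} D' k 𝓛') (hA' : IsAdapted 𝒯' 𝓛')
    {f : X ≃ₜ X'} (hf : IsThomMatherMorphism 𝒯 𝒯' f) (hreg : ∀ x, f x ∈ D'.reg ↔ x ∈ D.reg)
    {σ : Bubble D 𝓛 ≃ Bubble D' 𝓛'} (hσ : IsBubblePermutation D D' 𝓛 𝓛' f σ)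
    {z : Y} (hz : 𝓛 z ∉ D.reg) :
    ∃ H : Y → Y', ∀ᶠ y in nhds z, ContMDiffAt (𝓡 n) (𝓡 n') ∞ H y ∧
      (𝓛 y ∈ D.reg → IsPointLift f σ y (H y)) := by
  obtain ⟨s, a, ha, ⟨u₁, hu₁, hu⟩, αt, hαtd, hαti, hrange, hαt⟩ := hA z hz
  -- Any point over `f (𝓛 z)` will do: it only provides an unfolded bundle chart there.
  obtain ⟨z', hz'⟩ := h𝓛'.surjective (f (𝓛 z))
  obtain ⟨s', a', ha', ⟨u₁', hu₁', hu'⟩, αt', hαtd', -, hrange', hαt'⟩ :=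
    hA' z' (by rwa [hz', hreg])
  have : LocallyConnectedSpace ↥(D.stratum s) :=
    ChartedSpace.locallyConnectedSpace (EuclideanSpace ℝ (Fin (D.dim s))) _
  have : LocallyConnectedSpace a.U := a.U.isOpen.locallyConnectedSpace
  have : LocallyConnectedSpace (𝒯 s).link.carrier :=
    ChartedSpace.locallyConnectedSpace (EuclideanSpace ℝ (Fin (𝒯 s).link.dim)) _
  let u₀ : a.U := ⟨u₁, hu₁⟩
  obtain ⟨l₀, rfl⟩ := PemChart.exists_eq_apply_zero hrange hαt u₀ hu
  obtain ⟨Θ, hΘ⟩ := hf.exists_smooth_on_links hreg ha ha' (u₀ := u₀) (u₀' := ⟨u₁', hu₁'⟩)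
    (by rw [hu', hz', ← hu]) l₀
  obtain ⟨N₁, hN₁, N₂, hN₂, hN⟩ := mem_nhds_prod_iff.1 hΘ
  obtain ⟨M₁, hM₁, hM₁o, hu₀, hM₁c⟩ := locallyConnectedSpace_iff_subsets_isOpen_isConnected.1
    ‹LocallyConnectedSpace a.U› u₀ N₁ hN₁
  obtain ⟨M₂, hM₂, hM₂o, hl₀, hM₂c⟩ := locallyConnectedSpace_iff_subsets_isOpen_isConnected.1
    ‹LocallyConnectedSpace (𝒯 s).link.carrier› l₀ N₂ hN₂
  have hΘM : ∀ u ∈ M₁, ∀ l ∈ M₂, _ := fun u hu l hl => hN (mk_mem_prod (hM₁ hu) (hM₂ hl))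
  let q : ℝ → a.U × (𝒯 s).link.carrier × ℝ → Y' := fun ε p =>
    αt' ((Θ (p.1, p.2.1)).1, (Θ (p.1, p.2.1)).2, ε * p.2.2)
  have hqsmooth : ∀ ε, ∀ p : a.U × (𝒯 s).link.carrier × ℝ, p.1 ∈ M₁ → p.2.1 ∈ M₂ →
      ContMDiffAt (pemModel (D.dim s) (𝒯 s).link.dim) (𝓡 n') ∞ (q ε) p := by
    intro ε p hp₁ hp₂
    have h1 : ContMDiffAt (pemModel (D.dim s) (𝒯 s).link.dim)
        ((𝓡 (D'.dim s')).prod (𝓡 (𝒯' s').link.dim)) ∞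
        (fun p : a.U × (𝒯 s).link.carrier × ℝ => Θ (p.1, p.2.1)) p :=
      ContMDiffAt.comp p (hΘM _ hp₁ _ hp₂).1 (contMDiffAt_fst.prodMk contMDiffAt_snd.fst)
    have h2 : ContMDiffAt (pemModel (D.dim s) (𝒯 s).link.dim) 𝓘(ℝ, ℝ) ∞
        (fun p : a.U × (𝒯 s).link.carrier × ℝ => ε * p.2.2) p :=
      ((contDiff_const.mul contDiff_id).contMDiff (f := fun t : ℝ => ε * t)).contMDiffAt.comp p
        contMDiffAt_snd.snd
    exact hαtd'.contMDiff.contMDiffAt.comp p (h1.fst.prodMk (h1.snd.prodMk h2))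
  have hqcomm : ∀ ε : ℝ, |ε| = 1 → ∀ p : a.U × (𝒯 s).link.carrier × ℝ, p.1 ∈ M₁ → p.2.1 ∈ M₂ →
      𝓛' (q ε p) = f (𝓛 (αt p)) := by
    rintro ε hε ⟨u, l, t⟩ hp₁ hp₂
    have : Real.nnabs (ε * t) = Real.nnabs t := by
      rw [map_mul]
      have : Real.nnabs ε = 1 := by ext; simpa using hε
      rw [this, one_mul]
    simp only [q]
    rw [hαt', hαt, this]
    exact ((hΘM _ hp₁ _ hp₂).2 _).symm
  obtain ⟨ε, hε, hpos, hneg⟩ := IsPointLift.exists_sign h𝓛 hσ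
    (y₁ := αt (u₀, l₀, 1)) (y₂ := αt (u₀, l₀, -1)) (q := fun ε => q ε (u₀, l₀, 1))
    (fun h => by
      have : (1 : ℝ) = -1 := congrArg (fun p => p.2.2) (hαti h)
      norm_num at this)
    (by rw [hαt, hαt]; congr 3; ext; simp) (PemChart.apply_mem_reg_of_ne_zero hαt _ _ one_ne_zero)
    (fun w hw => by
      have := a'.eq_or_eq_neg_of_apply_eq hrange' hαt' (w := w) (u := (Θ (u₀, l₀)).1)
        (l := (Θ (u₀, l₀)).2) one_ne_zero
        (by rw [hw, hαt]; exact (hΘM _ hu₀ _ hl₀).2 _)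
      simpa [q] using this)
  have hε1 : |ε| = 1 := by rcases hε with rfl | rfl <;> simp
  -- Changing `ε` to `-ε` at `t = 1` has the same effect as keeping `ε` at `t = -1`.
  have hneg' : IsPointLift f σ (αt (u₀, l₀, -1)) (q ε (u₀, l₀, -1)) := by
    simpa [q] using hneg
  have hlift : ∀ p : a.U × (𝒯 s).link.carrier × ℝ, p.1 ∈ M₁ → p.2.1 ∈ M₂ → p.2.2 ≠ 0 →
      IsPointLift f σ (αt p) (q ε p) := by
    have hfreg : ∀ x, x ∈ D.reg → f x ∈ D'.reg := fun x => (hreg x).2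
    have main : ∀ I : Set ℝ, IsPreconnected I → 0 ∉ I → ∀ t₀ ∈ I,
        IsPointLift f σ (αt (u₀, l₀, t₀)) (q ε (u₀, l₀, t₀)) →
        ∀ p : a.U × (𝒯 s).link.carrier × ℝ, p.1 ∈ M₁ → p.2.1 ∈ M₂ → p.2.2 ∈ I →
          IsPointLift f σ (αt p) (q ε p) := by
      intro I hI h0 t₀ ht₀ h p hp₁ hp₂ hp₃
      exact IsPointLift.of_isPreconnected hfreg
        (hM₁c.isPreconnected.prod (hM₂c.isPreconnected.prod hI))
        hαtd.contMDiff.continuous.continuousOn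
        (fun p hp => (hqsmooth ε p hp.1 hp.2.1).continuousAt.continuousWithinAt)
        (fun p hp => PemChart.apply_mem_reg_of_ne_zero hαt _ _ fun h => h0 (h ▸ hp.2.2))
        (fun p hp => hqcomm ε hε1 p hp.1 hp.2.1) (x₀ := (u₀, l₀, t₀))
        ⟨hu₀, hl₀, ht₀⟩ h ⟨hp₁, hp₂, hp₃⟩
    intro p hp₁ hp₂ hp₃
    rcases lt_or_gt_of_ne hp₃ with h | h
    · exact main (Iio 0) isPreconnected_Iio (by simp) (-1) (by simp) hneg' p hp₁ hp₂ h
    · exact main (Ioi 0) isPreconnected_Ioi (by simp) 1 (by simp) hpos p hp₁ hp₂ h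
  obtain ⟨Ψ, hΨ, hΨeq⟩ := hαtd (u₀, l₀, 0)
  have hmem : αt (u₀, l₀, 0) ∈ Ψ.target := by
    rw [hΨeq hΨ]
    exact Ψ.map_source hΨ
  have hinv : Ψ.symm (αt (u₀, l₀, 0)) = (u₀, l₀, 0) := by
    rw [hΨeq hΨ]
    exact Ψ.left_inv hΨ
  refine ⟨fun y => q ε (Ψ.symm y), ?_⟩
  have hM : M₁ ×ˢ (M₂ ×ˢ (univ : Set ℝ)) ∈ nhds (Ψ.symm (αt (u₀, l₀, 0))) := by
    rw [hinv]
    exact (hM₁o.prod (hM₂o.prod isOpen_univ)).mem_nhds ⟨hu₀, hl₀, mem_univ _⟩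
  have hcont : ContinuousAt Ψ.symm (αt (u₀, l₀, 0)) :=
    (Ψ.symm.contMDiffOn.contMDiffAt (Ψ.open_target.mem_nhds hmem)).continuousAt
  filter_upwards [Ψ.open_target.mem_nhds hmem, hcont.preimage_mem_nhds hM] with y hy hyM
  refine ⟨(hqsmooth ε _ hyM.1 hyM.2.1).comp y
    (Ψ.symm.contMDiffOn.contMDiffAt (Ψ.open_target.mem_nhds hy)), fun hyreg => ?_⟩
  have hyeq : αt (Ψ.symm y) = y := (hΨeq (Ψ.map_target hy)).trans (Ψ.right_inv hy)
  -- If the last coordinate were `0`, then `y` would lie over the cone vertex, that is, over the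
  -- stratum.
  have h := hlift (Ψ.symm y) hyM.1 hyM.2.1 fun h0 => by
    have h1 : 𝓛 y = a.toFun ((Ψ.symm y).1, OpenCone.mk (Ψ.symm y).2.1 (Real.nnabs (Ψ.symm y).2.2)) := by
      rw [← hαt, hyeq]
    rw [h0, map_zero, OpenCone.mk_eq_vertex_iff.2 rfl, a.apply_vertex] at h1
    rw [h1] at hyreg
    exact D.notMem_reg_of_mem_stratum (Ψ.symm y).1.1.2 hyreg
  rwa [hyeq] at h

/-- A map defined pointwise by germs that agree on a dense set is smooth. -/
theorem exists_contMDiff_of_dense {E E' H H' M M' : Type*} [NormedAddCommGroup E] [NormedSpace ℝ E]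
    [NormedAddCommGroup E'] [NormedSpace ℝ E'] [TopologicalSpace H] [TopologicalSpace H']
    {I : ModelWithCorners ℝ E H} {I' : ModelWithCorners ℝ E' H'}
    [TopologicalSpace M] [ChartedSpace H M] [TopologicalSpace M'] [ChartedSpace H' M'] [T2Space M']
    {m : WithTop ℕ∞} {A : Set M} (hA : Dense A) {P : M → M' → Prop}
    (huniq : ∀ x ∈ A, ∀ y₁ y₂, P x y₁ → P x y₂ → y₁ = y₂)
    (hloc : ∀ z, ∃ F : M → M', ∀ᶠ x in nhds z, ContMDiffAt I I' m F x ∧ (x ∈ A → P x (F x))) :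
    ∃ F : M → M', ContMDiff I I' m F ∧ ∀ x ∈ A, P x (F x) := by
  choose G hG using hloc
  have hev : ∀ z, G z =ᶠ[nhds z] fun x => G x x := by
    intro z
    filter_upwards [(hG z).eventually_nhds] with x hx
    have : (nhdsWithin x A).NeBot := mem_closure_iff_nhdsWithin_neBot.1 (hA x)
    have h1 : Filter.Tendsto (G z) (nhdsWithin x A) (nhds (G z x)) :=
      hx.self_of_nhds.1.continuousAt.continuousWithinAt
    have h2 : Filter.Tendsto (G x) (nhdsWithin x A) (nhds (G x x)) :=
      (hG x).self_of_nhds.1.continuousAt.continuousWithinAt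
    refine tendsto_nhds_unique_of_eventuallyEq h1 h2 ?_
    filter_upwards [nhdsWithin_le_nhds hx, nhdsWithin_le_nhds (hG x), self_mem_nhdsWithin]
      with y hy₁ hy₂ hyA
    exact huniq y hyA _ _ (hy₁.2 hyA) (hy₂.2 hyA)
  exact ⟨fun x => G x x,
    fun z => (hG z).self_of_nhds.1.congr_of_eventuallyEq (hev z).symm,
    fun x hx => (hG x).self_of_nhds.2 hx⟩

theorem exists_smooth_isLifting [T2Space X'] [T2Space Y'] (h𝓛 : IsUnfolding.{u, v} D k 𝓛)
    (hA : IsAdapted 𝒯 𝓛) (h𝓛' : IsUnfolding.{w, v} D' k 𝓛') (hA' : IsAdapted 𝒯' 𝓛')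
    {f : X ≃ₜ X'} (hf : IsThomMatherIso 𝒯 𝒯' f)
    {σ : Bubble D 𝓛 ≃ Bubble D' 𝓛'} (hσ : IsBubblePermutation D D' 𝓛 𝓛' f σ) :
    ∃ F : Y → Y', ContMDiff (𝓡 n) (𝓡 n') ∞ F ∧ IsLifting D D' 𝓛 𝓛' f σ F := by
  obtain ⟨F, hF, hFlift⟩ := exists_contMDiff_of_dense (I := 𝓡 n) (I' := 𝓡 n') (m := ∞)
    hA.dense_preimage_reg (P := IsPointLift f σ)
    (fun y hy _ _ h₁ h₂ => h₁.unique h𝓛' hy h₂) fun z => by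
      by_cases hz : 𝓛 z ∈ D.reg
      · exact exists_smooth_pointLift_of_mem_reg h𝓛 h𝓛' hf.1.morphism hσ hz
      · exact exists_smooth_pointLift_of_notMem_reg h𝓛 hA h𝓛' hA' hf.1
          (fun _ => hf.apply_mem_reg_iff) hσ hz
  refine ⟨F, hF, hF.continuous, fun z => ?_, fun b y hb =>
    (hFlift y (bubbleSet_subset b hb)).mem b hb⟩
  -- Gluing controls `F` only over `reg`; density extends the commutation to the singular part.
  exact congrFun (Continuous.ext_on hA.dense_preimage_reg (h𝓛'.proper.continuous.comp hF.continuous)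
    (f.continuous.comp h𝓛.proper.continuous) fun y hy => (hFlift y hy).comm) z

theorem IsLifting.unique [T2Space Y'] (hA : IsAdapted 𝒯 𝓛) (h𝓛' : IsUnfolding.{w, v} D' k 𝓛')
    {f : X → X'} {σ : Bubble D 𝓛 ≃ Bubble D' 𝓛'} {F G : Y → Y'}
    (hF : IsLifting D D' 𝓛 𝓛' f σ F) (hG : IsLifting D D' 𝓛 𝓛' f σ G) : F = G :=
  Continuous.ext_on hA.dense_preimage_reg hF.continuous hG.continuous fun y hy =>
    (hF.isPointLift y).unique h𝓛' hy (hG.isPointLift y)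

end Extension

/-! ### Liftings of inverse maps -/

section Inverse

variable {n n' k : ℕ} {X : Type u} {X' : Type w} [TopologicalSpace X] [TopologicalSpace X']
  {D : SimpleSpace n X} {D' : SimpleSpace n' X'} {𝒯 : ThomMather.{u, v} D}
  {Y Y' : Type*} [TopologicalSpace Y] [TopologicalSpace Y']
  [ChartedSpace (EuclideanSpace ℝ (Fin n)) Y] {𝓛 : Y → X} {𝓛' : Y' → X'}

/-- Both `G ∘ F` and `id` lift the identity of `X` with the identity permutation. -/
theorem IsLifting.leftInverse [T2Space Y] (hA : IsAdapted 𝒯 𝓛) (h𝓛 : IsUnfolding.{u, v} D k 𝓛)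
    {f : X ≃ₜ X'} {σ : Bubble D 𝓛 ≃ Bubble D' 𝓛'} {F : Y → Y'} {G : Y' → Y}
    (hF : IsLifting D D' 𝓛 𝓛' f σ F) (hG : IsLifting D' D 𝓛' 𝓛 f.symm σ.symm G) :
    Function.LeftInverse G F := by
  have h₁ : IsLifting D D 𝓛 𝓛 id (Equiv.refl _) (G ∘ F) :=
    ⟨hG.continuous.comp hF.continuous, fun z => by simp [hG.comm, hF.comm],
      fun b z hz => by simpa using hG.mapsTo _ (hF.mapsTo b hz)⟩
  have h₂ : IsLifting D D 𝓛 𝓛 id (Equiv.refl _) id :=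
    ⟨continuous_id, fun _ => rfl, fun _ _ hz => hz⟩
  exact congrFun (h₁.unique hA h𝓛 h₂)

end Inverse

theorem mainTheorem3 {n n' k : ℕ} {X : Type u} {X' : Type w} {Y Y' : Type*}
    [TopologicalSpace X] [MetrizableSpace X] [SecondCountableTopology X]
    [TopologicalSpace X'] [MetrizableSpace X'] [SecondCountableTopology X']
    (D : SimpleSpace n X) (D' : SimpleSpace n' X')
    (𝒯 : ThomMather.{u, v} D) (𝒯' : ThomMather.{w, v} D')
    [TopologicalSpace Y] [T2Space Y] [SecondCountableTopology Y]
    [ChartedSpace (EuclideanSpace ℝ (Fin n)) Y] [IsManifold (𝓡 n) ∞ Y]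
    [TopologicalSpace Y'] [T2Space Y'] [SecondCountableTopology Y']
    [ChartedSpace (EuclideanSpace ℝ (Fin n')) Y'] [IsManifold (𝓡 n') ∞ Y']
    (𝓛 : Y → X) (h𝓛 : IsUnfolding.{u, v} D k 𝓛) (hA : IsAdapted 𝒯 𝓛)
    (𝓛' : Y' → X') (h𝓛' : IsUnfolding.{w, v} D' k 𝓛') (hA' : IsAdapted 𝒯' 𝓛')
    (f : X ≃ₜ X') (hf : IsThomMatherIso 𝒯 𝒯' f) :
    (∃ σ : Bubble D 𝓛 ≃ Bubble D' 𝓛', IsBubblePermutation D D' 𝓛 𝓛' f σ) ∧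
    ∀ σ : Bubble D 𝓛 ≃ Bubble D' 𝓛', IsBubblePermutation D D' 𝓛 𝓛' f σ →
      IsBubblePermutation D' D 𝓛' 𝓛 f.symm σ.symm ∧
      ∃ F : Diffeomorph (𝓡 n) (𝓡 n') Y Y' ∞,
        (∀ G : Y → Y', IsLifting D D' 𝓛 𝓛' f σ G ↔ G = F) ∧
        (∀ G : Y' → Y, IsLifting D' D 𝓛' 𝓛 f.symm σ.symm G ↔ G = F.symm) := by
  refine ⟨exists_isBubblePermutation h𝓛 h𝓛' f fun _ => hf.apply_mem_reg_iff, fun σ hσ =>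
    ⟨hσ.symm, ?_⟩⟩
  obtain ⟨F, hF, hFl⟩ := exists_smooth_isLifting h𝓛 hA h𝓛' hA' hf hσ
  obtain ⟨G, hG, hGl⟩ := exists_smooth_isLifting h𝓛' hA' h𝓛 hA hf.symm hσ.symm
  have hGF : Function.LeftInverse G F := hFl.leftInverse hA h𝓛 hGl
  have hFG : Function.LeftInverse F G := hGl.leftInverse hA' h𝓛' hFl
  refine ⟨⟨⟨F, G, hGF, hFG⟩, hF, hG⟩, fun F' => ⟨fun h => h.unique hA h𝓛' hFl, ?_⟩,
    fun G' => ⟨fun h => h.unique hA' h𝓛 hGl, ?_⟩⟩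
  · rintro rfl
    exact hFl
  · rintro rfl
    exact hGl
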